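/- Let $n\ge 2$, and let $K\subset\mathbb{R}^n$ be a convex body, i.e. a nonempty compact convex set (with possibly empty interior), of constant width $\Theta$: $\sup_{x\in K}\langle x,u\rangle+\sup_{x\in K}\langle x,-u\rangle=\Theta$ for every unit vector $u\in\mathbb{R}^n$. Let $\gamma=\varphi([a,b])$ be a curve, where $\varphi:[a,b]\to\mathbb{R}^n$ is continuous, and let $$\operatorname{length}(\gamma)=\sup\Big\{\sum_{i=1}^m |\varphi(t_i)-\varphi(t_{i-1})| : a=t_0<t_1<\dots<t_m=b\Big\}\in[0,\infty].$$ If the convex hull of $\gamma$ contains $K$, then $$\operatorname{length}(\gamma)\ \ge\ \frac{2(\pi-1)\,\Gamma\left(\frac{n+1}{2}\right)}{\sqrt{\pi}\,\Gamma\left(\frac n2\right)}\cdot\Theta .$$ -/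

import Mathlib

/-- The support function `h(K, u) = sup {⟪x, u⟫ | x ∈ K}` of a convex body `K` in `ℝⁿ`
(`ConvexBody`: a nonempty compact convex set, possibly with empty interior). -/
noncomputable def ConvexBody.supportFunction {n : ℕ}
    (K : ConvexBody (EuclideanSpace ℝ (Fin n))) (u : EuclideanSpace ℝ (Fin n)) : ℝ :=
  sSup ((fun x : EuclideanSpace ℝ (Fin n) => inner ℝ x u) '' (K : Set (EuclideanSpace ℝ (Fin n))))

/-- The width function `w(K, u) = h(K, u) + h(K, -u)`: for a unit vector `u`, the distance between
the two support hyperplanes of `K` orthogonal to `u`. -/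
noncomputable def ConvexBody.width {n : ℕ}
    (K : ConvexBody (EuclideanSpace ℝ (Fin n))) (u : EuclideanSpace ℝ (Fin n)) : ℝ :=
  K.supportFunction u + K.supportFunction (-u)

/-- `K` has constant width `Θ`: its width is `Θ` in the direction of every unit vector. -/
def ConvexBody.HasConstantWidth {n : ℕ}
    (K : ConvexBody (EuclideanSpace ℝ (Fin n))) (Θ : ℝ) : Prop :=
  ∀ u : EuclideanSpace ℝ (Fin n), ‖u‖ = 1 → K.width u = Θ

open MeasureTheory Set

/-! The only use of `K` is that the curve has extent at least `Θ` in every direction. A fine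
inscribed polygon keeps extent `Θ - 2 * ε` in each direction, so a bound for polygons suffices, with
`ε → 0` at the end.

For polygons, project to a 2-plane; the extents survive. The projected path has length at least `(π
- 1) Θ` (`pi_sub_one_mul_le_sum_planarNorm`). If its endpoints are at distance at most `Θ`, this is
the Cauchy–Crofton formula (`pi_mul_sub_le_sum_planarNorm`). Otherwise a connectedness argument
finds a direction in which the path both rises and falls by `Θ`, which gives `√5 Θ`
(`sqrt_five_mul_le_sum_planarNorm`), and `√5 > π - 1`.

Averaging over planes multiplies lengths by a constant depending only on `n`, by rotation invariance
(`averageNorm_eq`). Integrating against a Gaussian and exchanging the integrals identifies the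
constant (`averageNorm_mul_lintegral`). -/

/-! ### Variation of real sequences and integrals of `|cos|` -/

/-- Each `|d| + d` is nonnegative and at least `2 * d`, so the terms outside `[i, j)` may be dropped
and the rest telescopes. -/
theorem two_mul_sub_le_sum_abs_add (y : ℕ → ℝ) {i j m : ℕ} (hij : i ≤ j) (hjm : j ≤ m) :
    2 * (y j - y i) ≤ ∑ k ∈ Finset.range m, |y (k + 1) - y k| + (y m - y 0) := by
  rw [← Finset.sum_range_sub y m, ← Finset.sum_add_distrib, ← Finset.sum_Ico_sub y hij,
    Finset.mul_sum]
  calc _ ≤ ∑ k ∈ Finset.Ico i j, (|y (k + 1) - y k| + (y (k + 1) - y k)) :=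
        Finset.sum_le_sum fun k _ => by linarith [le_abs_self (y (k + 1) - y k)]
    _ ≤ _ := by
        refine Finset.sum_le_sum_of_subset_of_nonneg (fun k hk => ?_) fun k _ _ => by
          linarith [neg_abs_le (y (k + 1) - y k)]
        simp only [Finset.mem_Ico, Finset.mem_range] at *
        omega

theorem two_mul_sub_le_sum_abs_sub (y : ℕ → ℝ) {i j m : ℕ} (hij : i ≤ j) (hjm : j ≤ m) :
    2 * (y i - y j) ≤ ∑ k ∈ Finset.range m, |y (k + 1) - y k| - (y m - y 0) := by
  have h := two_mul_sub_le_sum_abs_add (fun k => -y k) hij hjm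
  simp only [neg_sub_neg] at h
  simp_rw [fun k => abs_sub_comm (y k) (y (k + 1))] at h
  linarith

theorem integral_abs_cos_two_pi : ∫ t in (0 : ℝ)..(2 * Real.pi), |Real.cos t| = 4 := by
  have hper : Function.Periodic (fun t => |Real.cos t|) (2 * Real.pi) := fun t => by simp
  have h := hper.intervalIntegral_add_eq 0 (-(Real.pi / 2))
  rw [zero_add] at h
  have hint : ∀ p q : ℝ, IntervalIntegrable (fun t => |Real.cos t|) volume p q := fun p q =>
    (Real.continuous_cos.abs).intervalIntegrable p q
  rw [h, ← intervalIntegral.integral_add_adjacent_intervals (b := Real.pi / 2) (hint _ _)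
    (hint _ _)]
  have h1 : ∫ t in (-(Real.pi / 2))..(Real.pi / 2), |Real.cos t| = 2 := by
    rw [intervalIntegral.integral_congr (g := Real.cos)]
    · rw [integral_cos]; simp; norm_num
    · intro t ht
      rw [uIcc_of_le (by linarith [Real.pi_pos])] at ht
      exact abs_of_nonneg (Real.cos_nonneg_of_mem_Icc ht)
  have h2 : ∫ t in (Real.pi / 2)..(-(Real.pi / 2) + 2 * Real.pi), |Real.cos t| = 2 := by
    rw [intervalIntegral.integral_congr (g := fun t => -Real.cos t)]
    · rw [intervalIntegral.integral_neg, integral_cos,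
        show -(Real.pi / 2) + 2 * Real.pi = 2 * Real.pi - Real.pi / 2 by ring,
        Real.sin_two_pi_sub]
      simp; norm_num
    · intro t ht
      rw [uIcc_of_le (by linarith [Real.pi_pos])] at ht
      exact abs_of_nonpos (Real.cos_nonpos_of_pi_div_two_le_of_le ht.1 (by linarith [ht.2]))
  rw [h1, h2]; norm_num

theorem integral_abs_cos_sin (p q : ℝ) :
    ∫ t in (0 : ℝ)..(2 * Real.pi), |p * Real.cos t + q * Real.sin t| =
      4 * √(p ^ 2 + q ^ 2) := by
  set z : ℂ := ⟨p, q⟩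
  have hz : ‖z‖ = √(p ^ 2 + q ^ 2) := by
    rw [Complex.norm_def, Complex.normSq_mk]; ring_nf
  have hp : p = ‖z‖ * Real.cos z.arg := by rw [Complex.norm_mul_cos_arg]
  have hq : q = ‖z‖ * Real.sin z.arg := by rw [Complex.norm_mul_sin_arg]
  have h1 : ∀ t : ℝ, |p * Real.cos t + q * Real.sin t| = ‖z‖ * |Real.cos (t - z.arg)| := by
    intro t
    have h : p * Real.cos t + q * Real.sin t = ‖z‖ * Real.cos (t - z.arg) := by
      conv_lhs => rw [hp, hq]
      rw [Real.cos_sub]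
      ring
    rw [h, abs_mul, abs_norm]
  have hper : Function.Periodic (fun t => |Real.cos t|) (2 * Real.pi) := fun t => by simp
  simp_rw [h1]
  rw [intervalIntegral.integral_const_mul,
    intervalIntegral.integral_comp_sub_right (fun t => |Real.cos t|)]
  have h2 := hper.intervalIntegral_add_eq (0 - z.arg) 0
  rw [show 0 - z.arg + 2 * Real.pi = 2 * Real.pi - z.arg by ring, zero_add] at h2
  rw [h2, integral_abs_cos_two_pi, hz, mul_comm]

/-! ### Planar paths of given width -/

section Planar

variable {E : Type*} [NormedAddCommGroup E] [InnerProductSpace ℝ E]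

/-- The norm of the orthogonal projection of `v` to the plane with orthonormal basis `e, f`. -/
noncomputable def planarNorm (e f v : E) : ℝ := √(inner ℝ v e ^ 2 + inner ℝ v f ^ 2)

/-- The unit vector at angle `t` in the plane with orthonormal basis `e, f`. -/
noncomputable def planarDir (e f : E) (t : ℝ) : E := Real.cos t • e + Real.sin t • f

theorem inner_planarDir (e f v : E) (t : ℝ) :
    inner ℝ v (planarDir e f t) = inner ℝ v e * Real.cos t + inner ℝ v f * Real.sin t := by
  simp only [planarDir, inner_add_right, inner_smul_right]; ring

theorem norm_planarDir {e f : E} (he : ‖e‖ = 1) (hf : ‖f‖ = 1) (hef : inner ℝ e f = 0) (t : ℝ) :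
    ‖planarDir e f t‖ = 1 := by
  have h : ‖planarDir e f t‖ ^ 2 = 1 := by
    rw [planarDir, norm_add_sq_real, inner_smul_left, inner_smul_right, hef, norm_smul, norm_smul,
      he, hf]
    simp [Real.cos_sq_add_sin_sq]
  nlinarith [norm_nonneg (planarDir e f t)]

theorem integral_abs_inner_planarDir (e f v : E) :
    ∫ t in (0 : ℝ)..(2 * Real.pi), |inner ℝ v (planarDir e f t)| = 4 * planarNorm e f v := by
  simp_rw [inner_planarDir]
  exact integral_abs_cos_sin _ _

theorem planarNorm_rotate (e f v : E) (t : ℝ) :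
    planarNorm (planarDir e f t) (planarDir e f (t + Real.pi / 2)) v = planarNorm e f v := by
  unfold planarNorm
  rw [inner_planarDir, inner_planarDir, Real.cos_add_pi_div_two, Real.sin_add_pi_div_two]
  congr 1
  linear_combination (inner ℝ v e ^ 2 + inner ℝ v f ^ 2) * Real.sin_sq_add_cos_sq t

theorem planarNorm_le_abs_add_abs (e f v : E) :
    planarNorm e f v ≤ |inner ℝ v e| + |inner ℝ v f| := by
  refine Real.sqrt_le_iff.2 ⟨by positivity, ?_⟩
  nlinarith [sq_abs (inner ℝ v e), sq_abs (inner ℝ v f), abs_nonneg (inner ℝ v e),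
    abs_nonneg (inner ℝ v f), mul_nonneg (abs_nonneg (inner ℝ v e)) (abs_nonneg (inner ℝ v f))]

theorem two_mul_abs_add_abs_le (e f v : E) :
    2 * |inner ℝ v e| + |inner ℝ v f| ≤ √5 * planarNorm e f v := by
  rw [planarNorm, ← Real.sqrt_mul (by norm_num)]
  refine Real.le_sqrt_of_sq_le ?_
  nlinarith [sq_abs (inner ℝ v e), sq_abs (inner ℝ v f),
    sq_nonneg (|inner ℝ v e| - 2 * |inner ℝ v f|)]

/-- Cauchy–Crofton: in each direction the variation is at least `2 * Θ` minus the endpoint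
displacement. Integrating over the angle turns each `|inner|` into four times a planar norm. -/
theorem pi_mul_sub_le_sum_planarNorm {e f : E} {x : ℕ → E} {m : ℕ} {Θ : ℝ}
    (hx : ∀ t, ∃ i ≤ m, ∃ j ≤ m, Θ ≤ inner ℝ (x j - x i) (planarDir e f t)) :
    Real.pi * Θ - planarNorm e f (x m - x 0) ≤
      ∑ k ∈ Finset.range m, planarNorm e f (x (k + 1) - x k) := by
  have hcont : ∀ v : E, Continuous fun t => |inner ℝ v (planarDir e f t)| := fun v => by
    unfold planarDir; fun_prop
  have hpt : ∀ t, 2 * Θ - |inner ℝ (x m - x 0) (planarDir e f t)| ≤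
      ∑ k ∈ Finset.range m, |inner ℝ (x (k + 1) - x k) (planarDir e f t)| := by
    intro t
    obtain ⟨i, hi, j, hj, h⟩ := hx t
    simp only [inner_sub_left] at h ⊢
    rcases le_total i j with hij | hij
    · have := two_mul_sub_le_sum_abs_add (fun k => inner ℝ (x k) (planarDir e f t)) hij hj
      have := le_abs_self (inner ℝ (x m) (planarDir e f t) - inner ℝ (x 0) (planarDir e f t))
      linarith
    · have := two_mul_sub_le_sum_abs_sub (fun k => inner ℝ (x k) (planarDir e f t)) hij hi
      have := neg_abs_le (inner ℝ (x m) (planarDir e f t) - inner ℝ (x 0) (planarDir e f t))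
      linarith
  have h := intervalIntegral.integral_mono (a := 0) (b := 2 * Real.pi) (μ := volume)
    (by positivity) (Continuous.intervalIntegrable (by have := hcont (x m - x 0); fun_prop) _ _)
    ((continuous_finsetSum (Finset.range m) fun k _ =>
      hcont (x (k + 1) - x k)).intervalIntegrable _ _) hpt
  rw [intervalIntegral.integral_sub (by simp) ((hcont _).intervalIntegrable _ _),
    intervalIntegral.integral_finsetSum fun k _ => (hcont _).intervalIntegrable _ _,
    integral_abs_inner_planarDir, intervalIntegral.integral_const] at h
  simp_rw [integral_abs_inner_planarDir] at h
  rw [← Finset.mul_sum] at h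
  simp only [smul_eq_mul, sub_zero] at h
  linarith

/-- The angles with a rise and those with a fall form closed sets that cover the line and are
exchanged by a half-turn. Both are therefore nonempty, and they meet by connectedness. -/
theorem exists_up_and_down {e f : E} {x : ℕ → E} {m : ℕ} {Θ : ℝ}
    (hx : ∀ t, ∃ i ≤ m, ∃ j ≤ m, Θ ≤ inner ℝ (x j - x i) (planarDir e f t)) :
    ∃ t, (∃ i j, i ≤ j ∧ j ≤ m ∧ Θ ≤ inner ℝ (x j - x i) (planarDir e f t)) ∧
      ∃ i j, i ≤ j ∧ j ≤ m ∧ Θ ≤ inner ℝ (x i - x j) (planarDir e f t) := by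
  have hcont : ∀ v : E, Continuous fun t => inner ℝ v (planarDir e f t) := fun v => by
    unfold planarDir; fun_prop
  let J : Finset (ℕ × ℕ) :=
    ((Finset.range (m + 1)) ×ˢ (Finset.range (m + 1))).filter fun p => p.1 ≤ p.2
  have hJ : ∀ p : ℕ × ℕ, p ∈ J ↔ p.1 ≤ p.2 ∧ p.2 ≤ m := by
    intro p
    simp only [J, Finset.mem_filter, Finset.mem_product, Finset.mem_range]
    omega
  let A : Set ℝ := ⋃ p ∈ J, {t | Θ ≤ inner ℝ (x p.2 - x p.1) (planarDir e f t)}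
  let B : Set ℝ := ⋃ p ∈ J, {t | Θ ≤ inner ℝ (x p.1 - x p.2) (planarDir e f t)}
  have hA : ∀ t, t ∈ A ↔ ∃ i j, i ≤ j ∧ j ≤ m ∧
      Θ ≤ inner ℝ (x j - x i) (planarDir e f t) := by
    intro t
    simp only [A, mem_iUnion, hJ, mem_ofPred_eq, Prod.exists, exists_prop, and_assoc]
  have hB : ∀ t, t ∈ B ↔ ∃ i j, i ≤ j ∧ j ≤ m ∧
      Θ ≤ inner ℝ (x i - x j) (planarDir e f t) := by
    intro t
    simp only [B, mem_iUnion, hJ, mem_ofPred_eq, Prod.exists, exists_prop, and_assoc]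
  have hAc : IsClosed A := isClosed_biUnion_finset fun p _ => isClosed_le continuous_const (hcont _)
  have hBc : IsClosed B := isClosed_biUnion_finset fun p _ => isClosed_le continuous_const (hcont _)
  have hAB : ∀ t, t ∈ A ∨ t ∈ B := by
    intro t
    obtain ⟨i, hi, j, hj, h⟩ := hx t
    rcases le_total i j with hij | hij
    · exact Or.inl ((hA t).2 ⟨i, j, hij, hj, h⟩)
    · exact Or.inr ((hB t).2 ⟨j, i, hij, hi, h⟩)
  have hneg : ∀ v : E, ∀ t, inner ℝ v (planarDir e f (t + Real.pi)) =
      -inner ℝ v (planarDir e f t) := by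
    intro v t
    rw [inner_planarDir, inner_planarDir, Real.cos_add_pi, Real.sin_add_pi]; ring
  have hAB' : ∀ t, t ∈ A → t + Real.pi ∈ B := by
    intro t ht
    obtain ⟨i, j, hij, hj, h⟩ := (hA t).1 ht
    exact (hB _).2 ⟨i, j, hij, hj, by rwa [hneg, ← inner_neg_left, neg_sub]⟩
  have hBA' : ∀ t, t ∈ B → t + Real.pi ∈ A := by
    intro t ht
    obtain ⟨i, j, hij, hj, h⟩ := (hB t).1 ht
    exact (hA _).2 ⟨i, j, hij, hj, by rwa [hneg, ← inner_neg_left, neg_sub]⟩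
  have hne : (univ ∩ A).Nonempty ∧ (univ ∩ B).Nonempty := by
    rcases hAB 0 with h | h
    · exact ⟨⟨0, trivial, h⟩, ⟨_, trivial, hAB' _ h⟩⟩
    · exact ⟨⟨_, trivial, hBA' _ h⟩, ⟨0, trivial, h⟩⟩
  obtain ⟨t, -, htA, htB⟩ := isPreconnected_closed_iff.1 isPreconnected_univ A B hAc hBc
    (fun t _ => hAB t) hne.1 hne.2
  exact ⟨t, (hA t).1 htA, (hB t).1 htB⟩

/-- In the direction of `exists_up_and_down` the variation is at least `2 * Θ` plus the
displacement; in the orthogonal one it is at least the displacement. Weighting these by 2 and 1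
gives at least `4 * Θ + Θ`, and Cauchy–Schwarz costs a factor `√5`. -/
theorem sqrt_five_mul_le_sum_planarNorm {e f : E} {x : ℕ → E} {m : ℕ} {Θ : ℝ}
    (hx : ∀ t, ∃ i ≤ m, ∃ j ≤ m, Θ ≤ inner ℝ (x j - x i) (planarDir e f t))
    (hd : Θ ≤ planarNorm e f (x m - x 0)) :
    √5 * Θ ≤ ∑ k ∈ Finset.range m, planarNorm e f (x (k + 1) - x k) := by
  obtain ⟨t, ⟨i, j, hij, hj, h1⟩, k, l, hkl, hl, h2⟩ := exists_up_and_down hx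
  rw [← planarNorm_rotate e f _ t] at hd
  simp_rw [← planarNorm_rotate e f _ t]
  set u := planarDir e f t
  set u' := planarDir e f (t + Real.pi / 2)
  have hY : 2 * Θ + |inner ℝ (x m - x 0) u| ≤
      ∑ k ∈ Finset.range m, |inner ℝ (x (k + 1) - x k) u| := by
    simp only [inner_sub_left] at h1 h2 ⊢
    have h3 := two_mul_sub_le_sum_abs_add (fun k => inner ℝ (x k) u) hij hj
    have h4 := two_mul_sub_le_sum_abs_sub (fun k => inner ℝ (x k) u) hkl hl
    rcases abs_cases (inner ℝ (x m) u - inner ℝ (x 0) u) with ⟨h, _⟩ | ⟨h, _⟩ <;> rw [h] <;>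
      linarith
  have hX : |inner ℝ (x m - x 0) u'| ≤
      ∑ k ∈ Finset.range m, |inner ℝ (x (k + 1) - x k) u'| := by
    rw [← Finset.sum_range_sub x m, sum_inner]
    exact Finset.abs_sum_le_sum_abs _ _
  have hsum := Finset.sum_le_sum fun k (_ : k ∈ Finset.range m) =>
    two_mul_abs_add_abs_le u u' (x (k + 1) - x k)
  rw [Finset.sum_add_distrib, ← Finset.mul_sum, ← Finset.mul_sum] at hsum
  have h5 := planarNorm_le_abs_add_abs u u' (x m - x 0)
  have h6 : 5 * Θ ≤ √5 * ∑ k ∈ Finset.range m, planarNorm u u' (x (k + 1) - x k) := by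
    linarith [abs_nonneg (inner ℝ (x m - x 0) u)]
  have h7 : √5 * √5 = 5 := Real.mul_self_sqrt (by norm_num)
  have h8 : 0 < √5 := by positivity
  refine le_of_mul_le_mul_left ?_ h8
  rwa [← mul_assoc, h7]

/-- A polygonal path in a plane all of whose widths are at least `Θ` has length at least
`(π - 1) Θ`. -/
theorem pi_sub_one_mul_le_sum_planarNorm {e f : E} {x : ℕ → E} {m : ℕ} {Θ : ℝ} (hΘ : 0 ≤ Θ)
    (hx : ∀ t, ∃ i ≤ m, ∃ j ≤ m, Θ ≤ inner ℝ (x j - x i) (planarDir e f t)) :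
    (Real.pi - 1) * Θ ≤ ∑ k ∈ Finset.range m, planarNorm e f (x (k + 1) - x k) := by
  rcases le_total (planarNorm e f (x m - x 0)) Θ with h | h
  · linarith [pi_mul_sub_le_sum_planarNorm hx]
  · refine le_trans (mul_le_mul_of_nonneg_right ?_ hΘ) (sqrt_five_mul_le_sum_planarNorm hx h)
    -- `π < 3.15` gives `(π - 1) ^ 2 < 5`.
    refine Real.le_sqrt_of_sq_le ?_
    nlinarith [Real.pi_gt_three, Real.pi_lt_d2]

end Planar

/-! ### Gaussian integrals of linear forms and norms -/

section GaussianMoments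

theorem integral_abs_mul_exp_neg_sq : ∫ t : ℝ, |t| * Real.exp (-t ^ 2) = 1 := by
  have h := integral_comp_abs (f := fun t => t * Real.exp (-t ^ 2))
  simp only [sq_abs] at h
  rw [h]
  have h2 := integral_rpow_mul_exp_neg_rpow (p := 2) (q := 1) (by norm_num) (by norm_num)
  norm_num at h2
  rw [h2]; norm_num

theorem integral_abs_apply_mul_exp_neg_norm_sq {n : ℕ} (i : Fin n) :
    ∫ w : EuclideanSpace ℝ (Fin n), |w i| * Real.exp (-‖w‖ ^ 2) = √Real.pi ^ (n - 1) := by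
  classical
  have h1 := (PiLp.volume_preserving_toLp (Fin n)).integral_comp
    (MeasurableEquiv.toLp 2 (Fin n → ℝ)).measurableEmbedding
    (fun w : EuclideanSpace ℝ (Fin n) => |w i| * Real.exp (-‖w‖ ^ 2))
  rw [← h1]
  have h2 : ∀ w : Fin n → ℝ, |(WithLp.toLp 2 w : EuclideanSpace ℝ (Fin n)) i| *
      Real.exp (-‖(WithLp.toLp 2 w : EuclideanSpace ℝ (Fin n))‖ ^ 2) =
      ∏ j, ((if j = i then |w j| else 1) * Real.exp (-(w j) ^ 2)) := by
    intro w
    rw [Finset.prod_mul_distrib, ← Real.exp_sum, EuclideanSpace.norm_sq_eq, Finset.sum_neg_distrib]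
    simp
  simp_rw [h2]
  rw [integral_fintype_prod_volume_eq_prod
    (f := fun j t => (if j = i then |t| else 1) * Real.exp (-t ^ 2))]
  have h3 : ∀ j, ∫ t : ℝ, (if j = i then |t| else 1) * Real.exp (-t ^ 2) =
      if j = i then 1 else √Real.pi := by
    intro j
    split_ifs with hj
    · exact integral_abs_mul_exp_neg_sq
    · simpa using integral_gaussian 1
  simp_rw [h3]
  rw [Finset.prod_ite]
  simp [Finset.filter_ne']

/-- The reflection in the hyperplane orthogonal to `v - w` does this. -/
theorem exists_linearIsometryEquiv_apply_eq {E : Type*} [NormedAddCommGroup E]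
    [InnerProductSpace ℝ E] {v w : E} (h : ‖v‖ = ‖w‖) : ∃ R : E ≃ₗᵢ[ℝ] E, R v = w :=
  ⟨_, Submodule.reflection_sub h⟩

theorem lintegral_abs_inner_mul_exp_neg_norm_sq {n : ℕ} (u : EuclideanSpace ℝ (Fin n))
    (hu : ‖u‖ = 1) :
    ∫⁻ w : EuclideanSpace ℝ (Fin n), ENNReal.ofReal (|inner ℝ w u| * Real.exp (-‖w‖ ^ 2)) =
      ENNReal.ofReal (√Real.pi ^ (n - 1)) := by
  obtain ⟨i⟩ : Nonempty (Fin n) := by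
    by_contra h
    rw [not_nonempty_iff] at h
    rw [Subsingleton.elim u 0, norm_zero] at hu
    exact zero_ne_one hu
  obtain ⟨R, hR⟩ := exists_linearIsometryEquiv_apply_eq
    (v := u) (w := EuclideanSpace.single i (1 : ℝ)) (by simp [hu])
  have h1 := R.measurePreserving.lintegral_comp_emb R.toMeasurableEquiv.measurableEmbedding
    (fun w => ENNReal.ofReal (|inner ℝ w (R u)| * Real.exp (-‖w‖ ^ 2)))
  simp only [LinearIsometryEquiv.inner_map_map, LinearIsometryEquiv.norm_map] at h1
  have h2 := integral_abs_apply_mul_exp_neg_norm_sq i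
  rw [h1, hR, ← h2, ofReal_integral_eq_lintegral_ofReal]
  · simp [EuclideanSpace.inner_single_right]
  -- A non-integrable function has Bochner integral zero, so the positive value already proves
  -- integrability.
  · refine Integrable.of_integral_ne_zero ?_
    rw [h2]; positivity
  · exact Filter.Eventually.of_forall fun w => by positivity

theorem lintegral_norm_mul_exp_neg_norm_sq {n : ℕ} (hn : n ≠ 0) :
    ∫⁻ w : EuclideanSpace ℝ (Fin n), ENNReal.ofReal (‖w‖ * Real.exp (-‖w‖ ^ 2)) =
      ENNReal.ofReal (√Real.pi ^ n * Real.Gamma (((n : ℝ) + 1) / 2) / Real.Gamma ((n : ℝ) / 2)) := by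
  have hn0 : (0 : ℝ) < n := by positivity
  have : Nonempty (Fin n) := ⟨⟨0, by omega⟩⟩
  have hg1 : 0 < Real.Gamma ((n : ℝ) / 2) := Real.Gamma_pos_of_pos (by positivity)
  have hg2 : 0 < Real.Gamma (((n : ℝ) + 1) / 2) := Real.Gamma_pos_of_pos (by positivity)
  have h2 : ∫ w : EuclideanSpace ℝ (Fin n), ‖w‖ * Real.exp (-‖w‖ ^ 2) =
      √Real.pi ^ n * Real.Gamma (((n : ℝ) + 1) / 2) / Real.Gamma ((n : ℝ) / 2) := by
    rw [integral_fun_norm_addHaar volume (fun r => r * Real.exp (-r ^ 2))]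
    have h3 : ∫ y in Ioi (0 : ℝ), y ^ (Module.finrank ℝ (EuclideanSpace ℝ (Fin n)) - 1) •
        (y * Real.exp (-y ^ 2)) = 1 / 2 * Real.Gamma (((n : ℝ) + 1) / 2) := by
      have h4 := integral_rpow_mul_exp_neg_rpow (p := 2) (q := n) (by norm_num) (by linarith)
      rw [← h4]
      refine setIntegral_congr_fun measurableSet_Ioi fun y hy => ?_
      simp only [finrank_euclideanSpace, Fintype.card_fin, smul_eq_mul, Real.rpow_natCast,
        Real.rpow_two]
      rw [← mul_assoc, ← pow_succ, Nat.sub_add_cancel (by omega)]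
    rw [h3, Measure.real, EuclideanSpace.volume_ball]
    have h5 : Real.Gamma ((n : ℝ) / 2 + 1) = n / 2 * Real.Gamma ((n : ℝ) / 2) :=
      Real.Gamma_add_one (by positivity)
    simp only [finrank_euclideanSpace, Fintype.card_fin, ENNReal.ofReal_one, one_pow, one_mul,
      smul_eq_mul, nsmul_eq_mul, h5]
    rw [ENNReal.toReal_ofReal (by positivity)]
    field_simp
  rw [← h2, ofReal_integral_eq_lintegral_ofReal]
  · refine Integrable.of_integral_ne_zero ?_
    rw [h2]; positivity
  · exact Filter.Eventually.of_forall fun w => by positivity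

theorem ofReal_planarNorm {E : Type*} [NormedAddCommGroup E] [InnerProductSpace ℝ E] (e f v : E) :
    ENNReal.ofReal (planarNorm e f v) = ENNReal.ofReal (1 / 4) *
      ∫⁻ t in Ioc (0 : ℝ) (2 * Real.pi), ENNReal.ofReal |inner ℝ v (planarDir e f t)| := by
  have hcont : Continuous fun t => |inner ℝ v (planarDir e f t)| := by
    unfold planarDir; fun_prop
  rw [← ofReal_integral_eq_lintegral_ofReal
    ((hcont.intervalIntegrable 0 (2 * Real.pi)).1)
    (Filter.Eventually.of_forall fun t => abs_nonneg _),
    ← intervalIntegral.integral_of_le (by positivity), integral_abs_inner_planarDir,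
    ← ENNReal.ofReal_mul (by norm_num)]
  congr 1
  ring

/-- The planar norm is an integral of `|inner|` over directions in the plane, and each direction
contributes the same Gaussian moment. The value does not depend on the plane. -/
theorem lintegral_planarNorm_mul_exp_neg_norm_sq {n : ℕ} {e f : EuclideanSpace ℝ (Fin n)}
    (he : ‖e‖ = 1) (hf : ‖f‖ = 1) (hef : inner ℝ e f = 0) :
    ∫⁻ w : EuclideanSpace ℝ (Fin n), ENNReal.ofReal (planarNorm e f w * Real.exp (-‖w‖ ^ 2)) =
      ENNReal.ofReal (Real.pi / 2 * √Real.pi ^ (n - 1)) := by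
  have h1 : ∀ w : EuclideanSpace ℝ (Fin n),
      ENNReal.ofReal (planarNorm e f w * Real.exp (-‖w‖ ^ 2)) = ENNReal.ofReal (1 / 4) *
        ∫⁻ t in Ioc (0 : ℝ) (2 * Real.pi),
          ENNReal.ofReal (|inner ℝ w (planarDir e f t)| * Real.exp (-‖w‖ ^ 2)) := by
    intro w
    rw [ENNReal.ofReal_mul (by unfold planarNorm; positivity), ofReal_planarNorm, mul_assoc,
      ← lintegral_mul_const']
    · simp_rw [ENNReal.ofReal_mul (abs_nonneg _)]
    · exact ENNReal.ofReal_ne_top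
  simp_rw [h1]
  rw [lintegral_const_mul' _ _ ENNReal.ofReal_ne_top, lintegral_lintegral_swap]
  · simp_rw [fun t => lintegral_abs_inner_mul_exp_neg_norm_sq _ (norm_planarDir he hf hef t)]
    rw [setLIntegral_const, Real.volume_Ioc, ← ENNReal.ofReal_mul (by positivity),
      ← ENNReal.ofReal_mul (by norm_num)]
    congr 1
    ring
  · refine Measurable.aemeasurable (Continuous.measurable ?_)
    unfold planarDir Function.uncurry
    refine ENNReal.continuous_ofReal.comp ?_
    fun_prop

end GaussianMoments

/-! ### Planes parametrized by pairs of vectors -/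

section Frames

variable {E : Type*} [NormedAddCommGroup E] [InnerProductSpace ℝ E]

/-- The component of `p.2` orthogonal to `p.1`, scaled by `‖p.1‖ ^ 2`. -/
noncomputable def orthComponent (p : E × E) : E :=
  ‖p.1‖ ^ 2 • p.2 - inner ℝ p.1 p.2 • p.1

/-- The norm of the projection of `v` to the plane spanned by `p.1` and `p.2`. -/
noncomputable def spanNorm (p : E × E) (v : E) : ℝ :=
  planarNorm (‖p.1‖⁻¹ • p.1) (‖orthComponent p‖⁻¹ • orthComponent p) v

/-- The linearly independent pairs of vectors in the unit ball. -/
def unitFrames (E : Type*) [NormedAddCommGroup E] [InnerProductSpace ℝ E] : Set (E × E) :=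
  {p | orthComponent p ≠ 0 ∧ ‖p‖ < 1}

theorem continuous_orthComponent : Continuous (orthComponent : E × E → E) := by
  unfold orthComponent; fun_prop

theorem isOpen_unitFrames : IsOpen (unitFrames E) :=
  (isOpen_ne_fun continuous_orthComponent continuous_const).inter
    (isOpen_lt continuous_norm continuous_const)

theorem orthComponent_map (R : E ≃ₗᵢ[ℝ] E) (p : E × E) :
    orthComponent (Prod.map R R p) = R (orthComponent p) := by
  simp [orthComponent]

theorem spanNorm_map (R : E ≃ₗᵢ[ℝ] E) (p : E × E) (v : E) :
    spanNorm (Prod.map R R p) (R v) = spanNorm p v := by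
  simp only [spanNorm, planarNorm, orthComponent_map]
  simp [inner_smul_right]

/-- The product carries the sup norm, so the bound restricts each vector separately and isometries
preserve it. -/
theorem preimage_unitFrames (R : E ≃ₗᵢ[ℝ] E) :
    Prod.map R R ⁻¹' unitFrames E = unitFrames E := by
  ext p
  simp only [unitFrames, mem_preimage, mem_ofPred_eq, orthComponent_map]
  simp [Prod.norm_def]

theorem fst_ne_zero_of_mem_unitFrames {p : E × E} (hp : p ∈ unitFrames E) : p.1 ≠ 0 := by
  intro h
  exact hp.1 (by simp [orthComponent, h])

theorem norm_inv_norm_smul {v : E} (hv : v ≠ 0) : ‖‖v‖⁻¹ • v‖ = 1 := by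
  rw [norm_smul, norm_inv, norm_norm, inv_mul_cancel₀ (norm_ne_zero_iff.2 hv)]

theorem inner_orthComponent (p : E × E) :
    inner ℝ (‖p.1‖⁻¹ • p.1) (‖orthComponent p‖⁻¹ • orthComponent p) = 0 := by
  rw [inner_smul_left, inner_smul_right]
  have : inner ℝ p.1 (orthComponent p) = 0 := by
    rw [orthComponent, inner_sub_right, inner_smul_right, inner_smul_right,
      real_inner_self_eq_norm_sq]
    ring
  rw [this]; simp

theorem spanNorm_smul (p : E × E) (c : ℝ) (v : E) : spanNorm p (c • v) = |c| * spanNorm p v := by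
  simp only [spanNorm, planarNorm, inner_smul_left, mul_pow, ← mul_add]
  rw [Real.sqrt_mul (by positivity)]
  simp [Real.sqrt_sq_eq_abs]

theorem spanNorm_nonneg (p : E × E) (v : E) : 0 ≤ spanNorm p v := Real.sqrt_nonneg _

variable [MeasurableSpace E] [BorelSpace E] [SecondCountableTopology E]

theorem measurable_spanNorm : Measurable fun q : (E × E) × E => spanNorm q.1 q.2 := by
  have h : Measurable fun q : (E × E) × E => orthComponent q.1 :=
    continuous_orthComponent.measurable.comp measurable_fst
  unfold spanNorm planarNorm
  fun_prop

theorem measurable_ofReal_spanNorm (v : E) :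
    Measurable fun p : E × E => ENNReal.ofReal (spanNorm p v) := by
  have h : Measurable fun p : E × E => (p, v) := by fun_prop
  exact (measurable_spanNorm.comp h).ennreal_ofReal

end Frames

/-! ### Averaging over planes -/

section Averaging

variable {n : ℕ}

/-- The total length of the projections of `v` to the planes spanned by pairs of vectors in
the unit ball. -/
noncomputable def averageNorm (v : EuclideanSpace ℝ (Fin n)) : ENNReal :=
  ∫⁻ p in unitFrames (EuclideanSpace ℝ (Fin n)), ENNReal.ofReal (spanNorm p v)

theorem averageNorm_map (R : EuclideanSpace ℝ (Fin n) ≃ₗᵢ[ℝ] EuclideanSpace ℝ (Fin n))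
    (v : EuclideanSpace ℝ (Fin n)) : averageNorm (R v) = averageNorm v := by
  have h1 : MeasurePreserving (Prod.map R R) (volume.prod volume) (volume.prod volume) :=
    R.measurePreserving.prod R.measurePreserving
  have h2 : MeasurableEmbedding (Prod.map R R) :=
    R.toMeasurableEquiv.measurableEmbedding.prodMap R.toMeasurableEquiv.measurableEmbedding
  have h := h1.setLIntegral_comp_preimage_emb h2
    (fun p => ENNReal.ofReal (spanNorm p (R v))) (unitFrames (EuclideanSpace ℝ (Fin n)))
  simp only [spanNorm_map, preimage_unitFrames] at h
  exact h.symm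

theorem averageNorm_smul (c : ℝ) (v : EuclideanSpace ℝ (Fin n)) :
    averageNorm (c • v) = ENNReal.ofReal |c| * averageNorm v := by
  unfold averageNorm
  simp_rw [spanNorm_smul, ENNReal.ofReal_mul (abs_nonneg c)]
  exact lintegral_const_mul' _ _ ENNReal.ofReal_ne_top

theorem averageNorm_eq {u : EuclideanSpace ℝ (Fin n)} (hu : ‖u‖ = 1)
    (v : EuclideanSpace ℝ (Fin n)) :
    averageNorm v = ENNReal.ofReal ‖v‖ * averageNorm u := by
  obtain ⟨R, hR⟩ := exists_linearIsometryEquiv_apply_eq (v := ‖v‖ • u) (w := v)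
    (by simp [norm_smul, hu])
  rw [← hR, averageNorm_map, averageNorm_smul, hR, abs_norm]

theorem volume_unitFrames_lt_top :
    volume (unitFrames (EuclideanSpace ℝ (Fin n))) < ⊤ := by
  refine Bornology.IsBounded.measure_lt_top
    ((Metric.isBounded_ball (x := 0) (r := 1)).subset fun p hp => ?_)
  simpa using hp.2

theorem volume_unitFrames_pos (hn : 2 ≤ n) :
    0 < volume (unitFrames (EuclideanSpace ℝ (Fin n))) := by
  refine isOpen_unitFrames.measure_pos _ ?_
  let i : Fin n := ⟨0, by omega⟩
  let j : Fin n := ⟨1, by omega⟩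
  have hij : j ≠ i := by simp [i, j]
  refine ⟨((1 / 2 : ℝ) • EuclideanSpace.single i (1 : ℝ),
    (1 / 2 : ℝ) • EuclideanSpace.single j (1 : ℝ)), ?_, ?_⟩
  · intro h
    have := congrArg (fun w : EuclideanSpace ℝ (Fin n) => w j) h
    simp [orthComponent, norm_smul, hij] at this
  · simp [Prod.norm_def, norm_smul]
    norm_num

/-- Both sides are the integral of `spanNorm p w * exp (-‖w‖ ^ 2)` over `p` and `w`, taken in the
two orders. -/
theorem averageNorm_mul_lintegral {u : EuclideanSpace ℝ (Fin n)} (hu : ‖u‖ = 1) :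
    averageNorm u *
        ∫⁻ w : EuclideanSpace ℝ (Fin n), ENNReal.ofReal (‖w‖ * Real.exp (-‖w‖ ^ 2)) =
      ENNReal.ofReal (Real.pi / 2 * √Real.pi ^ (n - 1)) *
        volume (unitFrames (EuclideanSpace ℝ (Fin n))) := by
  have hm : Measurable fun w : EuclideanSpace ℝ (Fin n) =>
      ENNReal.ofReal (‖w‖ * Real.exp (-‖w‖ ^ 2)) := by fun_prop
  rw [← lintegral_const_mul _ hm]
  have h1 : ∀ w : EuclideanSpace ℝ (Fin n),
      averageNorm u * ENNReal.ofReal (‖w‖ * Real.exp (-‖w‖ ^ 2)) =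
      ∫⁻ p in unitFrames (EuclideanSpace ℝ (Fin n)),
        ENNReal.ofReal (spanNorm p w * Real.exp (-‖w‖ ^ 2)) := by
    intro w
    rw [ENNReal.ofReal_mul (norm_nonneg w), ← mul_assoc, mul_comm (averageNorm u),
      ← averageNorm_eq hu, averageNorm, ← lintegral_mul_const' _ _ ENNReal.ofReal_ne_top]
    simp_rw [ENNReal.ofReal_mul (spanNorm_nonneg _ w)]
  simp_rw [h1]
  rw [lintegral_lintegral_swap, ← setLIntegral_const]
  · refine setLIntegral_congr_fun isOpen_unitFrames.measurableSet fun p hp => ?_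
    exact lintegral_planarNorm_mul_exp_neg_norm_sq
      (norm_inv_norm_smul (fst_ne_zero_of_mem_unitFrames hp)) (norm_inv_norm_smul hp.1)
      (inner_orthComponent p)
  · refine Measurable.aemeasurable (ENNReal.measurable_ofReal.comp ?_)
    have := (measurable_spanNorm (E := EuclideanSpace ℝ (Fin n))).comp measurable_swap
    exact this.mul (by fun_prop)

theorem ofReal_mul_volume_le_of_width_le {x : ℕ → EuclideanSpace ℝ (Fin n)} {m : ℕ}
    {Θ : ℝ} (hΘ : 0 ≤ Θ) (hx : ∀ u : EuclideanSpace ℝ (Fin n), ‖u‖ = 1 →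
      ∃ i ≤ m, ∃ j ≤ m, Θ ≤ inner ℝ (x j - x i) u)
    {u : EuclideanSpace ℝ (Fin n)} (hu : ‖u‖ = 1) :
    ENNReal.ofReal ((Real.pi - 1) * Θ) * volume (unitFrames (EuclideanSpace ℝ (Fin n))) ≤
      ENNReal.ofReal (∑ k ∈ Finset.range m, ‖x (k + 1) - x k‖) * averageNorm u := by
  calc ENNReal.ofReal ((Real.pi - 1) * Θ) * volume (unitFrames (EuclideanSpace ℝ (Fin n)))
      = ∫⁻ p in unitFrames (EuclideanSpace ℝ (Fin n)), ENNReal.ofReal ((Real.pi - 1) * Θ) :=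
        (setLIntegral_const _ _).symm
    _ ≤ ∫⁻ p in unitFrames (EuclideanSpace ℝ (Fin n)),
        ∑ k ∈ Finset.range m, ENNReal.ofReal (spanNorm p (x (k + 1) - x k)) := by
        refine setLIntegral_mono' isOpen_unitFrames.measurableSet fun p hp => ?_
        rw [← ENNReal.ofReal_sum_of_nonneg fun k _ => spanNorm_nonneg _ _]
        exact ENNReal.ofReal_le_ofReal (pi_sub_one_mul_le_sum_planarNorm hΘ fun t =>
          hx _ (norm_planarDir (norm_inv_norm_smul (fst_ne_zero_of_mem_unitFrames hp))
            (norm_inv_norm_smul hp.1) (inner_orthComponent p) t))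
    _ = ∑ k ∈ Finset.range m, averageNorm (x (k + 1) - x k) := by
        unfold averageNorm
        rw [lintegral_finsetSum _ fun k _ => measurable_ofReal_spanNorm (x (k + 1) - x k)]
    _ = ENNReal.ofReal (∑ k ∈ Finset.range m, ‖x (k + 1) - x k‖) * averageNorm u := by
        simp_rw [fun k => averageNorm_eq hu (x (k + 1) - x k)]
        rw [← Finset.sum_mul, ENNReal.ofReal_sum_of_nonneg fun k _ => norm_nonneg _]

/-- Eliminates the average `A`, whose finiteness is not needed, and cancels the volume `M`. -/
theorem mul_le_mul_of_ofReal_mul_le {p q r s : ℝ} {A M : ENNReal} (hM0 : M ≠ 0) (hM : M ≠ ⊤)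
    (hp : 0 ≤ p) (hq : 0 ≤ q) (hs : 0 ≤ s)
    (h1 : ENNReal.ofReal p * M ≤ ENNReal.ofReal q * A)
    (h2 : A * ENNReal.ofReal r = ENNReal.ofReal s * M) : p * r ≤ q * s := by
  rw [← ENNReal.ofReal_le_ofReal_iff (by positivity), ENNReal.ofReal_mul hp,
    ENNReal.ofReal_mul hq, ← ENNReal.mul_le_mul_iff_left hM0 hM, mul_assoc _ _ M,
    mul_assoc _ _ M, ← h2, mul_left_comm, ← mul_assoc, mul_comm (ENNReal.ofReal r),
    ← mul_assoc, mul_right_comm _ (ENNReal.ofReal r) M]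
  gcongr

/-- A polygonal path in `ℝⁿ` all of whose widths are at least `Θ` has length at least
`2 (π - 1) Γ((n + 1) / 2) / (√π Γ(n / 2)) * Θ`. -/
theorem le_sum_norm_of_width_le (hn : 2 ≤ n) {x : ℕ → EuclideanSpace ℝ (Fin n)} {m : ℕ} {Θ : ℝ}
    (hΘ : 0 ≤ Θ) (hx : ∀ u : EuclideanSpace ℝ (Fin n), ‖u‖ = 1 →
      ∃ i ≤ m, ∃ j ≤ m, Θ ≤ inner ℝ (x j - x i) u) :
    2 * (Real.pi - 1) * Real.Gamma (((n : ℝ) + 1) / 2) /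
        (√Real.pi * Real.Gamma ((n : ℝ) / 2)) * Θ ≤
      ∑ k ∈ Finset.range m, ‖x (k + 1) - x k‖ := by
  have hpi : 0 ≤ Real.pi - 1 := by linarith [Real.pi_gt_three]
  have hg : 0 < Real.Gamma ((n : ℝ) / 2) := Real.Gamma_pos_of_pos (by positivity)
  obtain ⟨u, hu⟩ : ∃ u : EuclideanSpace ℝ (Fin n), ‖u‖ = 1 :=
    ⟨EuclideanSpace.single ⟨0, by omega⟩ 1, by simp⟩
  have hC := averageNorm_mul_lintegral hu
  rw [lintegral_norm_mul_exp_neg_norm_sq (by omega)] at hC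
  have h := mul_le_mul_of_ofReal_mul_le (volume_unitFrames_pos hn).ne'
    volume_unitFrames_lt_top.ne (by positivity) (Finset.sum_nonneg fun k _ => norm_nonneg _)
    (by positivity) (ofReal_mul_volume_le_of_width_le hΘ hx hu) hC
  have hs : √Real.pi * √Real.pi = Real.pi := Real.mul_self_sqrt Real.pi_pos.le
  have hs0 : 0 < √Real.pi := Real.sqrt_pos.2 Real.pi_pos
  refine le_of_mul_le_mul_right ?_ (show 0 < Real.pi / 2 * √Real.pi ^ (n - 1) by positivity)
  refine le_trans (le_of_eq ?_) h
  rw [← pow_sub_one_mul (show n ≠ 0 by omega) (√Real.pi)]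
  field_simp
  rw [sq, hs]
  ring

end Averaging

/-! ### From curves to inscribed polygons -/

section Curve

variable {E : Type*} [NormedAddCommGroup E] [InnerProductSpace ℝ E]

theorem exists_inner_le_of_mem_convexHull {s : Set E} {p : E} (hp : p ∈ convexHull ℝ s) (u : E) :
    ∃ q ∈ s, inner ℝ p u ≤ inner ℝ q u := by
  by_contra! h
  have hc : Convex ℝ {q : E | inner ℝ q u < inner ℝ p u} := by
    have := (convex_Iio (𝕜 := ℝ) (inner ℝ p u)).is_linear_preimage
      (f := fun q : E => inner ℝ q u) ⟨fun _ _ => inner_add_left _ _ _, fun c v => by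
        simp [inner_smul_left]⟩
    exact this
  have hp' : inner ℝ p u < inner ℝ p u := convexHull_min (fun q hq => h q hq) hc hp
  exact lt_irrefl _ hp'

theorem exists_inner_eq_supportFunction {n : ℕ} (K : ConvexBody (EuclideanSpace ℝ (Fin n)))
    (u : EuclideanSpace ℝ (Fin n)) :
    ∃ p ∈ (K : Set (EuclideanSpace ℝ (Fin n))), inner ℝ p u = K.supportFunction u := by
  have h := (K.isCompact.image_of_continuousOn
    (f := fun x : EuclideanSpace ℝ (Fin n) => inner ℝ x u)
    (by fun_prop)).sSup_mem (K.nonempty.image _)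
  exact h

/-- A curve on a compact interval has arbitrarily fine inscribed polygons. -/
theorem exists_monotone_partition_dist_le {F : Type*} [PseudoMetricSpace F] {a b : ℝ}
    (hab : a ≤ b) {φ : ℝ → F} (hφ : ContinuousOn φ (Icc a b)) {ε : ℝ} (hε : 0 < ε) :
    ∃ (m : ℕ) (τ : ℕ → ℝ), Monotone τ ∧ (∀ k, τ k ∈ Icc a b) ∧
      ∀ t ∈ Icc a b, ∃ k ≤ m, dist (φ t) (φ (τ k)) ≤ ε := by
  obtain ⟨δ, hδ, H⟩ := Metric.uniformContinuousOn_iff_le.1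
    (isCompact_Icc.uniformContinuousOn_of_continuous hφ) ε hε
  obtain ⟨m, hm⟩ := exists_nat_gt ((b - a) / δ)
  have hmem : ∀ k : ℕ, min (a + k * δ) b ∈ Icc a b := fun k =>
    ⟨le_min (by linarith [mul_nonneg (Nat.cast_nonneg (α := ℝ) k) hδ.le]) hab, min_le_right _ _⟩
  -- Clamping at `b` keeps all the nodes in the interval, including those past the right end.
  refine ⟨m, fun k => min (a + k * δ) b, fun k l hkl => ?_, hmem, fun t ht => ?_⟩
  · exact min_le_min_right _ (by gcongr)
  · have h0 : 0 ≤ (t - a) / δ := div_nonneg (by linarith [ht.1]) hδ.le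
    have h1 := Nat.floor_le h0
    have h2 := (Nat.lt_floor_add_one ((t - a) / δ)).le
    rw [le_div_iff₀ hδ] at h1
    rw [div_le_iff₀ hδ] at h2
    refine ⟨⌊(t - a) / δ⌋₊, ?_, H t ht _ (hmem _) ?_⟩
    · refine Nat.floor_le_of_le (le_trans ?_ hm.le)
      gcongr
      exact ht.2
    · dsimp only
      rw [min_eq_left (by linarith [ht.2]), Real.dist_eq, abs_le]
      constructor <;> linarith

end Curve

theorem theorem3 (n : ℕ) (hn : 2 ≤ n) (K : ConvexBody (EuclideanSpace ℝ (Fin n))) (Θ : ℝ)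
    (hK : K.HasConstantWidth Θ) (a b : ℝ) (hab : a ≤ b) (φ : ℝ → EuclideanSpace ℝ (Fin n))
    (hφ : ContinuousOn φ (Set.Icc a b))
    (hcov : (K : Set (EuclideanSpace ℝ (Fin n))) ⊆ convexHull ℝ (φ '' Set.Icc a b)) :
    ENNReal.ofReal (2 * (Real.pi - 1) * Real.Gamma (((n : ℝ) + 1) / 2) /
        (Real.sqrt Real.pi * Real.Gamma ((n : ℝ) / 2)) * Θ) ≤
      eVariationOn φ (Set.Icc a b) := by
  have hpi : 0 ≤ Real.pi - 1 := by linarith [Real.pi_gt_three]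
  have hg1 : 0 < Real.Gamma ((n : ℝ) / 2) := Real.Gamma_pos_of_pos (by positivity)
  have hg2 : 0 < Real.Gamma (((n : ℝ) + 1) / 2) := Real.Gamma_pos_of_pos (by positivity)
  set c := 2 * (Real.pi - 1) * Real.Gamma (((n : ℝ) + 1) / 2) /
    (Real.sqrt Real.pi * Real.Gamma ((n : ℝ) / 2)) with hc
  have hc0 : 0 ≤ c := by positivity
  have hsup : ∀ u : EuclideanSpace ℝ (Fin n),
      ∃ t ∈ Icc a b, K.supportFunction u ≤ inner ℝ (φ t) u := by
    intro u
    obtain ⟨p, hp, hpu⟩ := exists_inner_eq_supportFunction K u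
    obtain ⟨_, ⟨t, ht, rfl⟩, hq⟩ := exists_inner_le_of_mem_convexHull (hcov hp) u
    exact ⟨t, ht, hpu ▸ hq⟩
  have key : ∀ ε : ℝ, 0 < ε →
      ENNReal.ofReal (c * (Θ - 2 * ε)) ≤ eVariationOn φ (Icc a b) := by
    intro ε hε
    rcases le_total (Θ - 2 * ε) 0 with hneg | hpos
    · rw [ENNReal.ofReal_of_nonpos (mul_nonpos_of_nonneg_of_nonpos hc0 hneg)]
      exact zero_le
    obtain ⟨m, τ, hτ, hmem, hnear⟩ := exists_monotone_partition_dist_le hab hφ hε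
    have hnear' : ∀ u : EuclideanSpace ℝ (Fin n), ‖u‖ = 1 →
        ∃ k ≤ m, K.supportFunction u - ε ≤ inner ℝ (φ (τ k)) u := by
      intro u hu
      obtain ⟨t, ht, h⟩ := hsup u
      obtain ⟨k, hk, hd⟩ := hnear t ht
      refine ⟨k, hk, ?_⟩
      have h1 := real_inner_le_norm (φ t - φ (τ k)) u
      rw [hu, mul_one, ← dist_eq_norm, inner_sub_left] at h1
      linarith
    -- The nodes lose `ε` at each of the two opposite supports, hence `2 * ε` in width.
    have hmain := le_sum_norm_of_width_le hn (x := fun k => φ (τ k)) (m := m) hpos (by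
      intro u hu
      obtain ⟨j, hj, h1⟩ := hnear' u hu
      obtain ⟨i, hi, h2⟩ := hnear' (-u) (by rwa [norm_neg])
      have hw : K.supportFunction u + K.supportFunction (-u) = Θ := hK u hu
      refine ⟨i, hi, j, hj, ?_⟩
      rw [inner_neg_right] at h2
      rw [inner_sub_left]
      linarith)
    calc ENNReal.ofReal (c * (Θ - 2 * ε))
        ≤ ENNReal.ofReal (∑ k ∈ Finset.range m, ‖φ (τ (k + 1)) - φ (τ k)‖) :=
          ENNReal.ofReal_le_ofReal hmain
      _ = ∑ k ∈ Finset.range m, edist (φ (τ (k + 1))) (φ (τ k)) := by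
          rw [ENNReal.ofReal_sum_of_nonneg fun k _ => norm_nonneg _]
          simp_rw [edist_dist, dist_eq_norm]
      _ ≤ eVariationOn φ (Icc a b) := eVariationOn.sum_le hτ hmem
  have hlim : Filter.Tendsto (fun ε : ℝ => ENNReal.ofReal (c * (Θ - 2 * ε)))
      (nhdsWithin 0 (Ioi 0)) (nhds (ENNReal.ofReal (c * Θ))) := by
    have hcont : Continuous fun ε : ℝ => ENNReal.ofReal (c * (Θ - 2 * ε)) :=
      ENNReal.continuous_ofReal.comp (by fun_prop)
    simpa using (hcont.tendsto 0).mono_left nhdsWithin_le_nhds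
  exact le_of_tendsto hlim (Filter.eventually_of_mem self_mem_nhdsWithin key)
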